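/- Let $n\ge 2$, $k\ge 1$ and $D\ge 1$ be integers, let $0<r<1$, and let $0<q\le p<1$. Draw labels $z_1,\dots,z_n$ i.i.d. uniformly from $[k]=\{1,\dots,k\}$ and define the symmetric matrix $M\in[0,1]^{n\times n}$ by $M_{ii}=0$ and, for $i\ne j$, $M_{ij}=p$ if $z_i=z_j$ and $M_{ij}=q$ if $z_i\neq z_j$; write $\mathbb{P}_{\mathrm{SBM}(p,q)}$ for the law of $M$. Given $M$, let $A\in\{0,1\}^{n\times n}$ be the symmetric adjacency matrix with zero diagonal whose entries $A_{ij}$, $i<j$, are independent with $A_{ij}\sim\mathrm{Bern}(M_{ij})$. For $\widehat M\in\mathbb{R}^{n\times n}$ put $$\ell(\widehat M,M)=\binom n2^{-1}\sum_{1\le i<j\le n}(\widehat M_{ij}-M_{ij})^2,$$ and let $\mathbb{R}[A]^{n\times n}_{\le D}$ be the set of estimators $\widehat M=\widehat M(A)$ each of whose $n^2$ entries is a real polynomial of degree at most $D$ in the entries of $A$. If $$\frac{(p-q)^2}{q(1-p)}\le\frac{r}{(D(D+1))^2}\,\min\Big(\frac{k^2}{n},1\Big),$$ then $$\inf_{\widehat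 M\in\mathbb{R}[A]^{n\times n}_{\le D}}\ \mathbb{E}_{A,\,M\sim\mathbb{P}_{\mathrm{SBM}(p,q)}}\big[\ell(\widehat M,M)\big]\ \ge\ \frac{(p-q)^2}{k}-(p-q)^2\left(\frac1{k^2}+\frac{r(2-r)}{(1-r)^2\,n}\right).$$ -/

import Mathlib

open MeasureTheory ProbabilityTheory

noncomputable section

/-- The vertex pairs `i < j` of `[n]`. -/
abbrev VertexPair (n : ℕ) : Type := {e : Fin n × Fin n // e.1 < e.2}

/-- The connectivity matrix of a label vector `z ∈ [k]^n`: zero diagonal, `p` for two distinct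
vertices with the same label, `q` for two vertices with different labels. -/
def sbmMatrix {n k : ℕ} (p q : unitInterval) (z : Fin n → Fin k) : Fin n → Fin n → unitInterval :=
  fun i j => if i = j then 0 else if z i = z j then p else q

/-- The prior `P_SBM(p,q)` on connectivity matrices: the law of `sbmMatrix p q z` when the labels
`z 1, …, z n` are independent and uniform on `[k]`. -/
def sbmPrior (n k : ℕ) (p q : unitInterval) : Measure (Fin n → Fin n → unitInterval) :=
  (Measure.pi fun _ : Fin n => uniformOn (Set.univ : Set (Fin k))).map (sbmMatrix p q)

/-- The law of the random graph given `M`: the edge indicators `a i j`, `i < j`, are independent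
Bernoulli variables with success probabilities `M i j`. -/
def graphLaw {n : ℕ} (M : Fin n → Fin n → unitInterval) : Measure (VertexPair n → Bool) :=
  Measure.pi fun e => bernoulliMeasure true false (M e.1.1 e.1.2)

/-- The adjacency matrix of a graph given by its edge indicators: symmetric, with zero diagonal. -/
def adjacency {n : ℕ} (a : VertexPair n → Bool) : Matrix (Fin n) (Fin n) ℝ :=
  fun i j =>
    if h : i < j then (if a ⟨(i, j), h⟩ then 1 else 0)
    else if h : j < i then (if a ⟨(j, i), h⟩ then 1 else 0)
    else 0

/-- The estimators all of whose entries are polynomials of (total) degree at most `D` in the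
entries of the observed matrix. -/
def lowDegreeEstimators (n D : ℕ) : Set (Matrix (Fin n) (Fin n) ℝ → Matrix (Fin n) (Fin n) ℝ) :=
  {Mhat | ∀ i j, ∃ f : MvPolynomial (Fin n × Fin n) ℝ, f.totalDegree ≤ D ∧
    ∀ A, Mhat A i j = MvPolynomial.eval (fun e : Fin n × Fin n => A e.1 e.2) f}

/-- The empirical loss: the average of `(M̂ i j - M i j)²` over the pairs `i < j`. -/
def empiricalLoss {n : ℕ} (Mhat : Matrix (Fin n) (Fin n) ℝ) (M : Fin n → Fin n → unitInterval) :
    ℝ :=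
  (1 / (n.choose 2 : ℝ)) * ∑ e : VertexPair n, (Mhat e.1.1 e.1.2 - (M e.1.1 e.1.2 : ℝ)) ^ 2

/-- The Bayes risk of an estimator: the expected loss when `M` is drawn from the prior and,
given `M`, the graph is drawn from `graphLaw M`. -/
def sbmBayesRisk (n k : ℕ) (p q : unitInterval)
    (Mhat : Matrix (Fin n) (Fin n) ℝ → Matrix (Fin n) (Fin n) ℝ) : ℝ :=
  ∫ M, (∫ a, empiricalLoss (Mhat (adjacency a)) M ∂(graphLaw M)) ∂(sbmPrior n k p q)

/-- There is an estimator of degree at most `D`, and the Bayes risks are bounded below, so that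
their infimum over these estimators is a genuine one. -/
instance (n D : ℕ) : Nonempty (lowDegreeEstimators n D) :=
  ⟨⟨fun _ _ _ => 0, fun _ _ => ⟨0, by simp, fun _ => by simp⟩⟩⟩

theorem bddBelow_sbmBayesRisk (n k D : ℕ) (p q : unitInterval) :
    BddBelow (Set.range fun Mhat : lowDegreeEstimators n D => sbmBayesRisk n k p q Mhat.1) := by
  refine ⟨0, ?_⟩
  rintro _ ⟨Mhat, rfl⟩
  refine integral_nonneg fun M => integral_nonneg fun a => ?_
  simp only [empiricalLoss]
  positivity

end

/-!
The Bayes risk is an average over vertex pairs, so it suffices to bound the error with which a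
polynomial of degree at most `D` in the edge indicators `Y` predicts a single entry `M e₀`. Up to an
affine change, this entry is the agreement indicator `B e₀ = 1{z i = z j}`, and the conditional edge
probabilities are `X e = q + (p - q) B e`.

The lower bound comes from a dual certificate: a random variable `g`, not a polynomial of `Y` alone,
with `𝔼 (f g) = 𝔼 (f x)` for the target `x` and every `f` of degree at most `D`. Then
`𝔼 (f - x)² ≥ 𝔼 x² - 𝔼 g²`. Here `g` combines the products over edge sets `S` of the scores
`(Y e - X e) / (X e (1 - X e))`, which are orthogonal given the labels, have second moment at most
`(q (1 - p)) ^ (-#S)`, and have covariance `1` with their own bit whatever `X e` is. In the basis of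
products of `Y e - q`, the correlation condition is a triangular system for the coefficients of `g`,
and its solution is, up to powers of `p - q`, the joint cumulant `κ T` of `B e₀` with the `B e`,
`e ∈ T` (`bitPoly_risk_ge`, `sum_agreeCumulant_mul`).

It remains to bound `∑ κ T ² s ^ #T` with `s = (p - q)² / (q (1 - p))`. The empty set gives `1 / k²`.
A cumulant vanishes as soon as its arguments split into two independent parts. This rules out an
edge set that is not linked to `e₀`, has a pendant vertex off `e₀`, or misses a vertex of `e₀`; a
degree count then leaves only graphs with `#T = d ≥ 1` edges and `v < d` vertices off `e₀`
(`card_spanned_le`). For these, the recursion gives `|κ T| ≤ (d + 1) ^ d / k ^ (v + 1)`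
(`abs_agreeCumulant_le`), and there are at most `n ^ v (d²) ^ d` of them
(`card_filter_spanned_le`). The hypothesis on `s` makes each pair `(d, v)` contribute at most
`r ^ d / n`, and `∑ d r ^ d = r / (1 - r)²` is at most `r (2 - r) / (1 - r)²`.
-/

/-! ### Low-degree polynomials of conditionally independent bits -/

section LowDegree

open Finset BigOperators

/-- The mean of `F` under independent bits with success probabilities `θ e`. -/
def bitMean {E : Type*} [Fintype E] [DecidableEq E] (θ : E → ℝ) (F : (E → Bool) → ℝ) : ℝ :=
  ∑ a, (∏ e, if a e then θ e else 1 - θ e) * F a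

/-- A bit as a real number. -/
def bitVal (b : Bool) : ℝ := if b then 1 else 0

/-- The functions of the bits that are polynomials of degree at most `D`: since bits are
idempotent, these are the combinations of the monomials `∏ e ∈ T, a e` with `#T ≤ D`. -/
def bitPoly (E : Type*) (D : ℕ) : Submodule ℝ ((E → Bool) → ℝ) :=
  Submodule.span ℝ {f | ∃ T : Finset E, #T ≤ D ∧ f = fun a => ∏ e ∈ T, bitVal (a e)}

theorem bitMean_prod {E : Type*} [Fintype E] [DecidableEq E] (θ : E → ℝ) (g : E → Bool → ℝ) :
    bitMean θ (fun a => ∏ e, g e (a e)) = ∏ e, (θ e * g e true + (1 - θ e) * g e false) := by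
  have h : ∀ e, θ e * g e true + (1 - θ e) * g e false =
      ∑ b : Bool, (if b then θ e else 1 - θ e) * g e b := fun e => by simp
  simp_rw [h, Finset.prod_univ_sum, Fintype.piFinset_univ, bitMean, ← Finset.prod_mul_distrib]

theorem bitMean_add {E : Type*} [Fintype E] [DecidableEq E] (θ : E → ℝ) (F G : (E → Bool) → ℝ) :
    bitMean θ (fun a => F a + G a) = bitMean θ F + bitMean θ G := by
  simp [bitMean, mul_add, Finset.sum_add_distrib]

theorem bitMean_const_mul {E : Type*} [Fintype E] [DecidableEq E] (θ : E → ℝ) (c : ℝ)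
    (F : (E → Bool) → ℝ) :
    bitMean θ (fun a => c * F a) = c * bitMean θ F := by
  simp only [bitMean, Finset.mul_sum]
  exact Finset.sum_congr rfl fun a _ => by ring

theorem bitMean_sum {E ι : Type*} [Fintype E] [DecidableEq E] (s : Finset ι) (θ : E → ℝ)
    (F : ι → (E → Bool) → ℝ) :
    bitMean θ (fun a => ∑ i ∈ s, F i a) = ∑ i ∈ s, bitMean θ (F i) := by
  simp only [bitMean, Finset.mul_sum]
  exact Finset.sum_comm

theorem bitMean_const {E : Type*} [Fintype E] [DecidableEq E] (θ : E → ℝ) (c : ℝ) : bitMean θ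
    (fun _ => c) = c := by
  have h := bitMean_prod θ (fun _ _ => (1 : ℝ))
  have h2 := bitMean_const_mul θ c (fun _ => 1)
  simp only [Finset.prod_const_one, mul_one] at h h2
  rw [h2, h]
  simp

theorem bitMean_nonneg {E : Type*} [Fintype E] [DecidableEq E] {θ : E → ℝ} (h0 : ∀ e, 0 ≤ θ e)
    (h1 : ∀ e, θ e ≤ 1)
    {F : (E → Bool) → ℝ} (hF : ∀ a, 0 ≤ F a) : 0 ≤ bitMean θ F := by
  refine Finset.sum_nonneg fun a _ => mul_nonneg (Finset.prod_nonneg fun e _ => ?_) (hF a)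
  split_ifs
  · exact h0 e
  · linarith [h1 e]

/-- The score of a bit of success probability `t`, normalised so that its covariance with the bit
is `1`, whatever `t` is. -/
noncomputable def score (t : ℝ) (b : Bool) : ℝ := (bitVal b - t) / (t * (1 - t))

theorem bitMean_score_mul_score {E : Type*} [Fintype E] [DecidableEq E] {θ : E → ℝ}
    (h0 : ∀ e, 0 < θ e) (h1 : ∀ e, θ e < 1)
    (S T : Finset E) :
    bitMean θ (fun a => (∏ e ∈ S, score (θ e) (a e)) * ∏ e ∈ T, score (θ e) (a e)) =
      if S = T then ∏ e ∈ S, 1 / (θ e * (1 - θ e)) else 0 := by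
  have hform : (fun a : E → Bool =>
      (∏ e ∈ S, score (θ e) (a e)) * ∏ e ∈ T, score (θ e) (a e)) =
      fun a => ∏ e, ((if e ∈ S then score (θ e) (a e) else 1) *
        (if e ∈ T then score (θ e) (a e) else 1)) := by
    funext a
    simp only [Finset.prod_mul_distrib, Finset.prod_ite_mem, Finset.univ_inter]
  rw [hform]
  refine (bitMean_prod θ fun e b => (if e ∈ S then score (θ e) b else 1) *
    (if e ∈ T then score (θ e) b else 1)).trans ?_
  split_ifs with hST
  · subst hST
    rw [← Finset.univ_inter S, ← Finset.prod_ite_mem]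
    refine Finset.prod_congr rfl fun e _ => ?_
    have := (h0 e).ne'
    have : 1 - θ e ≠ 0 := by linarith [h1 e]
    by_cases he : e ∈ S
    · simp [he, score, bitVal]
      field_simp
      ring
    · simp [he]
  · obtain ⟨e, he⟩ : ∃ e, ¬ (e ∈ S ↔ e ∈ T) := by
      by_contra! h
      exact hST (Finset.ext h)
    refine Finset.prod_eq_zero (Finset.mem_univ e) ?_
    have := (h0 e).ne'
    have : 1 - θ e ≠ 0 := by linarith [h1 e]
    by_cases hS : e ∈ S <;> by_cases hT : e ∈ T <;> simp_all [score, bitVal] <;>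
      field_simp <;> ring

theorem bitMean_shift_mul_score {E : Type*} [Fintype E] [DecidableEq E] {θ : E → ℝ}
    (h0 : ∀ e, 0 < θ e) (h1 : ∀ e, θ e < 1) (q : ℝ)
    (S T : Finset E) :
    bitMean θ (fun a => (∏ e ∈ T, (bitVal (a e) - q)) * ∏ e ∈ S, score (θ e) (a e)) =
      if S ⊆ T then ∏ e ∈ T \ S, (θ e - q) else 0 := by
  have hform : (fun a : E → Bool =>
      (∏ e ∈ T, (bitVal (a e) - q)) * ∏ e ∈ S, score (θ e) (a e)) =
      fun a => ∏ e, ((if e ∈ T then (bitVal (a e) - q) else 1) *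
        (if e ∈ S then score (θ e) (a e) else 1)) := by
    funext a
    simp only [Finset.prod_mul_distrib, Finset.prod_ite_mem, Finset.univ_inter]
  rw [hform]
  refine (bitMean_prod θ fun e b => (if e ∈ T then (bitVal b - q) else 1) *
    (if e ∈ S then score (θ e) b else 1)).trans ?_
  split_ifs with hST
  · rw [← Finset.univ_inter (T \ S), ← Finset.prod_ite_mem]
    refine Finset.prod_congr rfl fun e _ => ?_
    have := (h0 e).ne'
    have : 1 - θ e ≠ 0 := by linarith [h1 e]
    by_cases hS : e ∈ S
    · have hT := hST hS
      simp [hS, hT, score, bitVal]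
      field_simp
      ring
    · by_cases hT : e ∈ T
      · simp [hS, hT, bitVal]
        ring
      · simp [hS, hT]
  · obtain ⟨e, hS, hT⟩ := Finset.not_subset.1 hST
    refine Finset.prod_eq_zero (Finset.mem_univ e) ?_
    have := (h0 e).ne'
    have : 1 - θ e ≠ 0 := by linarith [h1 e]
    simp [hS, hT, score, bitVal]
    field_simp
    ring

/-- Shifting the bits by a constant does not enlarge the degree. -/
theorem bitPoly_le_span_shift {E : Type*} [DecidableEq E] (D : ℕ) (q : ℝ) :
    bitPoly E D ≤ Submodule.span ℝ
      {f | ∃ T : Finset E, #T ≤ D ∧ f = fun a => ∏ e ∈ T, (bitVal (a e) - q)} := by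
  refine Submodule.span_le.2 ?_
  rintro _ ⟨T, hT, rfl⟩
  have h : (fun a : E → Bool => ∏ e ∈ T, bitVal (a e)) =
      ∑ S ∈ T.powerset, (q ^ #(T \ S)) • fun a => ∏ e ∈ S, (bitVal (a e) - q) := by
    funext a
    have := Finset.prod_add (fun e => bitVal (a e) - q) (fun _ => q) T
    simp only [sub_add_cancel, Finset.prod_const] at this
    rw [this, Finset.sum_apply]
    exact Finset.sum_congr rfl fun S _ => by simp [mul_comm]
  rw [h]
  refine Submodule.sum_mem _ fun S hS => Submodule.smul_mem _ _ (Submodule.subset_span ?_)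
  exact ⟨S, (Finset.card_le_card (Finset.mem_powerset.1 hS)).trans hT, rfl⟩

/-- **Low-degree lower bound.** The bits are conditionally independent given a uniform `z`, with
success probabilities `X z e ∈ [q, p]`. If `w` solves the triangular system `hw`, then the
combination `g = ∑ w S ∏ e ∈ S, score` has the same correlation as the target `x` with every
polynomial of degree at most `D`, so that no such polynomial predicts `x` with an error below
`𝔼 x² - 𝔼 g²`. -/
theorem bitPoly_risk_ge {Z E : Type*} [Fintype Z] [Fintype E] [DecidableEq E] [Nonempty Z]
    (X : Z → E → ℝ) (x : Z → ℝ) {p q : ℝ} (hq : 0 < q)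
    (hp : p < 1) (hqX : ∀ z e, q ≤ X z e) (hXp : ∀ z e, X z e ≤ p) (D : ℕ) (w : Finset E → ℝ)
    (hw : ∀ T : Finset E, #T ≤ D →
      ∑ S ∈ T.powerset, w S * 𝔼 z, ∏ e ∈ T \ S, (X z e - q) =
        𝔼 z, x z * ∏ e ∈ T, (X z e - q))
    {f : (E → Bool) → ℝ} (hf : f ∈ bitPoly E D) :
    𝔼 z, x z ^ 2 - ∑ S : Finset E with #S ≤ D, w S ^ 2 / (q * (1 - p)) ^ #S ≤
      𝔼 z, bitMean (X z) (fun a => (f a - x z) ^ 2) := by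
  have hX0 : ∀ z e, 0 < X z e := fun z e => hq.trans_le (hqX z e)
  have hX1 : ∀ z e, X z e < 1 := fun z e => (hXp z e).trans_lt hp
  set 𝒮 : Finset (Finset E) := {S | #S ≤ D} with h𝒮
  set g : Z → (E → Bool) → ℝ := fun z a => ∑ S ∈ 𝒮, w S * ∏ e ∈ S, score (X z e) (a e) with hg
  -- `g` and `x` have the same correlation with every polynomial of degree at most `D`
  have hcorr : 𝔼 z, bitMean (X z) (fun a => f a * (g z a - x z)) = 0 := by
    refine Submodule.span_induction
      (p := fun f _ => 𝔼 z, bitMean (X z) (fun a => f a * (g z a - x z)) = 0)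
      ?_ ?_ ?_ ?_ (bitPoly_le_span_shift D q hf)
    · rintro _ ⟨T, hT, rfl⟩
      have h1 : ∀ z, bitMean (X z)
          (fun a => (∏ e ∈ T, (bitVal (a e) - q)) * (g z a - x z)) =
          (∑ S ∈ T.powerset, w S * ∏ e ∈ T \ S, (X z e - q)) -
            x z * ∏ e ∈ T, (X z e - q) := by
        intro z
        have e1 : (fun a : E → Bool => (∏ e ∈ T, (bitVal (a e) - q)) * (g z a - x z)) =
            fun a => (∑ S ∈ 𝒮, w S * ((∏ e ∈ T, (bitVal (a e) - q)) *
              ∏ e ∈ S, score (X z e) (a e))) + (-x z) * ((∏ e ∈ T, (bitVal (a e) - q)) *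
                ∏ e ∈ (∅ : Finset E), score (X z e) (a e)) := by
          funext a
          simp only [hg, mul_sub, Finset.mul_sum, Finset.prod_empty]
          rw [sub_eq_add_neg]
          congr 1
          · exact Finset.sum_congr rfl fun S _ => by ring
          · ring
        rw [e1, bitMean_add, bitMean_sum, bitMean_const_mul,
          bitMean_shift_mul_score (hX0 z) (hX1 z)]
        simp only [bitMean_const_mul, bitMean_shift_mul_score (hX0 z) (hX1 z)]
        simp only [mul_ite, mul_zero, Finset.empty_subset, if_true, Finset.sdiff_empty]
        rw [← Finset.sum_filter, neg_mul, ← sub_eq_add_neg]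
        congr 1
        refine Finset.sum_congr ?_ fun _ _ => rfl
        ext S
        simp only [h𝒮, Finset.mem_filter, Finset.mem_univ, true_and, Finset.mem_powerset]
        exact ⟨fun h => h.2, fun h => ⟨(Finset.card_le_card h).trans hT, h⟩⟩
      simp_rw [h1, Finset.expect_sub_distrib, Finset.expect_sum_comm, ← Finset.mul_expect]
      rw [hw T hT, sub_self]
    · simp [bitMean]
    · intro f₁ f₂ _ _ h₁ h₂
      simp only [Pi.add_apply, add_mul, bitMean_add, Finset.expect_add_distrib, h₁, h₂, add_zero]
    · intro c f _ h
      simp only [Pi.smul_apply, smul_eq_mul, mul_assoc, bitMean_const_mul, ← Finset.mul_expect, h,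
        mul_zero]
  have hsq : ∀ z, bitMean (X z) (fun a => g z a ^ 2) ≤
      ∑ S ∈ 𝒮, w S ^ 2 / (q * (1 - p)) ^ #S := by
    intro z
    have e1 : (fun a => g z a ^ 2) = fun a => ∑ S ∈ 𝒮, ∑ T ∈ 𝒮, (w S * w T) *
        ((∏ e ∈ S, score (X z e) (a e)) * ∏ e ∈ T, score (X z e) (a e)) := by
      funext a
      simp only [hg, sq, Finset.sum_mul_sum]
      exact Finset.sum_congr rfl fun S _ => Finset.sum_congr rfl fun T _ => by ring
    rw [e1, bitMean_sum]
    refine Finset.sum_le_sum fun S hS => ?_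
    rw [bitMean_sum]
    simp only [bitMean_const_mul, bitMean_score_mul_score (hX0 z) (hX1 z), mul_ite, mul_zero,
      Finset.sum_ite_eq, hS, if_true]
    rw [← sq, div_eq_mul_inv, ← inv_pow, ← Finset.prod_const]
    refine mul_le_mul_of_nonneg_left (Finset.prod_le_prod (fun e _ => ?_) fun e _ => ?_)
      (sq_nonneg _)
    · have := hX0 z e
      have := hX1 z e
      exact (one_div_pos.2 (mul_pos ‹_› (by linarith))).le
    · rw [one_div]
      refine inv_anti₀ (mul_pos hq (by linarith)) ?_
      exact mul_le_mul (hqX z e) (by linarith [hXp z e]) (by linarith) (hX0 z e).le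
  have hdecomp : ∀ z, bitMean (X z) (fun a => (f a - x z) ^ 2) =
      bitMean (X z) (fun a => (f a - g z a) ^ 2) +
        2 * bitMean (X z) (fun a => f a * (g z a - x z)) + x z ^ 2 -
          bitMean (X z) (fun a => g z a ^ 2) := by
    intro z
    have hconst := bitMean_const (X z) (x z ^ 2)
    rw [eq_sub_iff_add_eq, ← bitMean_const_mul, ← bitMean_add, ← hconst, ← bitMean_add,
      ← bitMean_add]
    congr 1
    funext a
    ring
  have hlow : ∀ z, x z ^ 2 - ∑ S ∈ 𝒮, w S ^ 2 / (q * (1 - p)) ^ #S +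
      2 * bitMean (X z) (fun a => f a * (g z a - x z)) ≤
        bitMean (X z) (fun a => (f a - x z) ^ 2) := by
    intro z
    have h1 := bitMean_nonneg (fun e => (hX0 z e).le) (fun e => (hX1 z e).le)
      (F := fun a => (f a - g z a) ^ 2) fun a => sq_nonneg _
    linarith [hdecomp z, hsq z]
  have := Finset.expect_le_expect (s := Finset.univ) fun z _ => hlow z
  rw [Finset.expect_add_distrib, Finset.expect_sub_distrib, ← Finset.mul_expect, hcorr,
    Finset.expect_const Finset.univ_nonempty] at this
  linarith

end LowDegree

/-! ### Moments of the agreement indicators of uniform labels -/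

section Agreement

open Finset BigOperators

theorem expect_mul_of_dependsOn {ι α : Type*} [Fintype ι] [DecidableEq ι] [Fintype α] [Nonempty α]
    {F G : (ι → α) → ℝ} {W : Finset ι} (hF : DependsOn F (W : Set ι))
    (hG : DependsOn G ((Wᶜ : Finset ι) : Set ι)) :
    𝔼 z, F z * G z = (𝔼 z, F z) * 𝔼 z, G z := by
  -- exchanging the coordinates outside `W` of two independent copies turns `G z.2` into `G z.1`
  let swap : (ι → α) × (ι → α) → (ι → α) × (ι → α) :=
    fun x => (W.piecewise x.1 x.2, W.piecewise x.2 x.1)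
  have hswap : Function.Involutive swap := by
    rintro ⟨x, y⟩
    refine Prod.ext (funext fun i => ?_) (funext fun i => ?_) <;>
      by_cases hi : i ∈ W <;> simp [swap, hi]
  have h1 : 𝔼 x : (ι → α) × (ι → α), F x.1 * G x.2 =
      𝔼 x : (ι → α) × (ι → α), F x.1 * G x.1 := by
    refine Fintype.expect_equiv hswap.toPerm _ _ fun x => ?_
    congr 1
    · exact hF fun i hi => by
        simp [swap, Finset.piecewise_eq_of_mem _ _ _ (Finset.mem_coe.1 hi)]
    · refine hG fun i hi => ?_
      have : i ∉ W := by simpa using hi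
      simp [swap, this]
  rw [← Finset.univ_product_univ, Finset.expect_product, Finset.expect_product] at h1
  simp only [Finset.expect_const Finset.univ_nonempty] at h1
  rw [Finset.expect_mul_expect, h1]

theorem expect_update {ι α : Type*} [Fintype ι] [DecidableEq ι] [Fintype α] [Nonempty α]
    (F : (ι → α) → ℝ) (u : ι) :
    𝔼 z, F z = 𝔼 z, 𝔼 c, F (Function.update z u c) := by
  let swap : (ι → α) × α → (ι → α) × α := fun x => (Function.update x.1 u x.2, x.1 u)
  have hswap : Function.Involutive swap := by
    rintro ⟨x, y⟩
    simp [swap]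
  have h1 : 𝔼 x : (ι → α) × α, F (Function.update x.1 u x.2) = 𝔼 x : (ι → α) × α, F x.1 :=
    Fintype.expect_equiv hswap.toPerm _ _ fun x => rfl
  rw [← Finset.univ_product_univ, Finset.expect_product, Finset.expect_product] at h1
  simp only [Finset.expect_const Finset.univ_nonempty] at h1
  exact h1.symm

variable {n k : ℕ}

/-- The two endpoints of a vertex pair. -/
def ends (e : VertexPair n) : Finset (Fin n) := {e.1.1, e.1.2}

theorem card_ends (e : VertexPair n) : #(ends e) = 2 := Finset.card_pair e.2.ne

theorem ends_injective : Function.Injective (ends (n := n)) := by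
  rintro ⟨⟨a, b⟩, hab⟩ ⟨⟨c, d⟩, hcd⟩ h
  simp only at hab hcd
  have ha : a ∈ ({c, d} : Finset (Fin n)) := by
    rw [show ({c, d} : Finset (Fin n)) = {a, b} from h.symm]; simp
  have hb : b ∈ ({c, d} : Finset (Fin n)) := by
    rw [show ({c, d} : Finset (Fin n)) = {a, b} from h.symm]; simp
  simp only [Finset.mem_insert, Finset.mem_singleton] at ha hb
  have : a = c ∧ b = d := by
    rcases ha with rfl | rfl <;> rcases hb with rfl | rfl
    · exact absurd hab (lt_irrefl _)
    · exact ⟨rfl, rfl⟩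
    · exact absurd hab hcd.asymm
    · exact absurd hab (lt_irrefl _)
  simp [this.1, this.2]

/-- The indicator that the endpoints of `e` have the same label. -/
def agree (z : Fin n → Fin k) (e : VertexPair n) : ℝ := if z e.1.1 = z e.1.2 then 1 else 0

/-- The probability, for uniform labels in `[k]`, that every edge of `T` joins two vertices with
the same label. -/
noncomputable def agreeMean (k : ℕ) (T : Finset (VertexPair n)) : ℝ :=
  𝔼 z : Fin n → Fin k, ∏ e ∈ T, agree z e

theorem agree_congr {z z' : Fin n → Fin k} {e : VertexPair n} (h : ∀ u ∈ ends e, z u = z' u) :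
    agree z e = agree z' e := by
  simp [agree, h e.1.1 (by simp [ends]), h e.1.2 (by simp [ends])]

theorem prod_agree (z : Fin n → Fin k) (T : Finset (VertexPair n)) :
    ∏ e ∈ T, agree z e = if ∀ e ∈ T, z e.1.1 = z e.1.2 then 1 else 0 := by
  simp only [agree, Finset.prod_ite_zero, Finset.prod_const_one]

theorem agreeMean_nonneg (T : Finset (VertexPair n)) : 0 ≤ agreeMean k T :=
  Finset.expect_nonneg fun z _ => Finset.prod_nonneg fun e _ => by
    unfold agree; split_ifs <;> norm_num

theorem agreeMean_empty [NeZero k] : agreeMean k (∅ : Finset (VertexPair n)) = 1 := by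
  simp [agreeMean]

theorem agreeMean_union [NeZero k] {S T : Finset (VertexPair n)} (W : Finset (Fin n))
    (hS : ∀ e ∈ S, ends e ⊆ W) (hT : ∀ e ∈ T, Disjoint (ends e) W) :
    agreeMean k (S ∪ T) = agreeMean k S * agreeMean k T := by
  have hdisj : Disjoint S T := by
    refine Finset.disjoint_left.2 fun e he he' => ?_
    have h1 := hS e he (show e.1.1 ∈ ends e by simp [ends])
    exact Finset.disjoint_left.1 (hT e he') (by simp [ends]) h1
  simp only [agreeMean, Finset.prod_union hdisj]
  refine expect_mul_of_dependsOn (W := W) (fun z z' h => ?_) (fun z z' h => ?_)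
  · exact Finset.prod_congr rfl fun e he => agree_congr fun u hu => h u (hS e he hu)
  · exact Finset.prod_congr rfl fun e he => agree_congr fun u hu => h u (by
      simpa using Finset.disjoint_left.1 (hT e he) hu)

/-- A pendant edge agrees with probability `1 / k`, independently of the other edges. -/
theorem agreeMean_insert_pendant [NeZero k] {S : Finset (VertexPair n)} {e : VertexPair n}
    {u : Fin n} (hu : u ∈ ends e) (hS : ∀ e' ∈ S, u ∉ ends e') :
    agreeMean k (insert e S) = agreeMean k S * (1 / k) := by
  have heS : e ∉ S := fun h => hS e h hu
  have hk : (Fintype.card (Fin k) : ℝ) = k := by simp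
  simp only [agreeMean, Finset.prod_insert heS]
  rw [expect_update _ u, Finset.expect_mul]
  refine Finset.expect_congr rfl fun z _ => ?_
  have h1 : ∀ c : Fin k, ∏ e' ∈ S, agree (Function.update z u c) e' = ∏ e' ∈ S, agree z e' := by
    intro c
    refine Finset.prod_congr rfl fun e' he' => agree_congr fun v hv => ?_
    rw [Function.update_of_ne]
    rintro rfl
    exact hS e' he' hv
  simp only [h1, ← Finset.expect_mul]
  rw [mul_comm]
  congr 1
  have hne := e.2.ne
  rw [Fintype.expect_eq_sum_div_card, hk]
  congr 1
  simp only [ends, Finset.mem_insert, Finset.mem_singleton] at hu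
  rcases hu with rfl | rfl
  · simp [agree, Function.update_of_ne hne.symm]
  · simp [agree, Function.update_of_ne hne]

/-- If the labels off `U` determine those on `U` as soon as the edges of `R` agree, then the edges
of `R` agree with probability at most `k ^ (-#U)`. -/
theorem agreeMean_le [NeZero k] {R : Finset (VertexPair n)} (U : Finset (Fin n))
    (h : ∀ z z' : Fin n → Fin k, (∀ e ∈ R, z e.1.1 = z e.1.2) → (∀ e ∈ R, z' e.1.1 = z' e.1.2) →
      (∀ u ∉ U, z u = z' u) → z = z') :
    agreeMean k R ≤ 1 / (k : ℝ) ^ #U := by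
  have hk : (0 : ℝ) < k := by exact_mod_cast Nat.pos_of_ne_zero (NeZero.ne k)
  have hcard : #{z : Fin n → Fin k | ∀ e ∈ R, z e.1.1 = z e.1.2} ≤ k ^ (n - #U) := by
    have : #(Finset.univ : Finset ({u : Fin n // u ∉ U} → Fin k)) = k ^ (n - #U) := by
      simp [Fintype.card_subtype_compl]
    rw [← this]
    refine Finset.card_le_card_of_injOn (fun z u => z u.1) (fun _ _ => Finset.mem_univ _) ?_
    intro z hz z' hz' hzz'
    simp only [Finset.coe_filter, Finset.mem_univ, true_and, Set.mem_ofPred_eq] at hz hz'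
    exact h z z' hz hz' fun u hu => congrFun hzz' ⟨u, hu⟩
  have hU : #U ≤ n := by simpa using Finset.card_le_univ U
  rw [agreeMean, Fintype.expect_eq_sum_div_card]
  simp only [prod_agree, Finset.sum_boole, Fintype.card_fun, Fintype.card_fin, Nat.cast_pow]
  rw [div_le_div_iff₀ (by positivity) (by positivity), one_mul]
  calc (#{z : Fin n → Fin k | ∀ e ∈ R, z e.1.1 = z e.1.2} : ℝ) * (k : ℝ) ^ #U
      ≤ (k : ℝ) ^ (n - #U) * (k : ℝ) ^ #U := by
        gcongr
        exact_mod_cast hcard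
    _ = (k : ℝ) ^ n := by rw [← pow_add, Nat.sub_add_cancel hU]

end Agreement

/-! ### Cumulants of the agreement indicators -/

section Cumulant

open Finset BigOperators

variable {n k : ℕ}

/-- The joint cumulant of the agreement indicator of `e₀` with those of the edges of `T`, defined
by the triangular recursion in which the certificate of `bitPoly_risk_ge` is to be solved. -/
noncomputable def agreeCumulant (k : ℕ) (e₀ : VertexPair n) (T : Finset (VertexPair n)) : ℝ :=
  agreeMean k (insert e₀ T) -
    ∑ S : {S // S ∈ T.ssubsets}, agreeCumulant k e₀ S.1 * agreeMean k (T \ S.1)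
termination_by #T
decreasing_by exact Finset.card_lt_card (Finset.mem_ssubsets.1 S.2)

theorem agreeCumulant_eq (k : ℕ) (e₀ : VertexPair n) (T : Finset (VertexPair n)) :
    agreeCumulant k e₀ T = agreeMean k (insert e₀ T) -
      ∑ S ∈ T.ssubsets, agreeCumulant k e₀ S * agreeMean k (T \ S) := by
  rw [agreeCumulant, Finset.sum_coe_sort T.ssubsets
    fun S => agreeCumulant k e₀ S * agreeMean k (T \ S)]

theorem sum_agreeCumulant_mul [NeZero k] (e₀ : VertexPair n) (T : Finset (VertexPair n)) :
    ∑ S ∈ T.powerset, agreeCumulant k e₀ S * agreeMean k (T \ S) = agreeMean k (insert e₀ T) := by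
  rw [← Finset.add_sum_erase _ _ (Finset.mem_powerset_self T), Finset.sdiff_self, agreeMean_empty,
    mul_one, agreeCumulant_eq]
  exact sub_add_cancel _ _

/-- A cumulant vanishes if part of its arguments is independent of the others. -/
theorem agreeCumulant_eq_zero_of_split [NeZero k] {e₀ : VertexPair n}
    {T₁ T₂ : Finset (VertexPair n)} (hne : T₂.Nonempty) (hd : Disjoint T₁ T₂)
    (hins : ∀ S₁ ⊆ T₁, ∀ S₂ ⊆ T₂,
      agreeMean k (insert e₀ (S₁ ∪ S₂)) = agreeMean k (insert e₀ S₁) * agreeMean k S₂)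
    (hmul : ∀ S₁ ⊆ T₁, ∀ S₂ ⊆ T₂,
      agreeMean k (S₁ ∪ S₂) = agreeMean k S₁ * agreeMean k S₂) :
    agreeCumulant k e₀ (T₁ ∪ T₂) = 0 := by
  induction hN : #(T₁ ∪ T₂) using Nat.strong_induction_on generalizing T₁ T₂ with
  | _ N ih =>
  have hsub : T₁.powerset ⊆ (T₁ ∪ T₂).ssubsets := by
    intro S hS
    rw [Finset.mem_powerset] at hS
    obtain ⟨e, he⟩ := hne
    refine Finset.mem_ssubsets.2 ⟨hS.trans Finset.subset_union_left, fun h => ?_⟩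
    exact Finset.disjoint_left.1 hd (hS (h (Finset.mem_union_right _ he))) he
  have hzero : ∀ S ∈ (T₁ ∪ T₂).ssubsets, S ∉ T₁.powerset →
      agreeCumulant k e₀ S * agreeMean k ((T₁ ∪ T₂) \ S) = 0 := by
    intro S hS hS1
    have hS' := Finset.mem_ssubsets.1 hS
    have hdecomp : S = (S ∩ T₁) ∪ (S ∩ T₂) := by
      rw [← Finset.inter_union_distrib_left]
      exact (Finset.inter_eq_left.2 hS'.1).symm
    have hlt : #((S ∩ T₁) ∪ (S ∩ T₂)) < N := by
      rw [← hdecomp, ← hN]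
      exact Finset.card_lt_card hS'
    have hne' : (S ∩ T₂).Nonempty := by
      obtain ⟨e, he, he1⟩ := Finset.not_subset.1 (fun h => hS1 (Finset.mem_powerset.2 h))
      rcases Finset.mem_union.1 (hS'.1 he) with h | h
      · exact absurd h he1
      · exact ⟨e, Finset.mem_inter.2 ⟨he, h⟩⟩
    have := ih _ hlt hne' (hd.mono Finset.inter_subset_right Finset.inter_subset_right)
      (fun S₁ h₁ S₂ h₂ => hins S₁ (h₁.trans Finset.inter_subset_right) S₂
        (h₂.trans Finset.inter_subset_right))
      (fun S₁ h₁ S₂ h₂ => hmul S₁ (h₁.trans Finset.inter_subset_right) S₂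
        (h₂.trans Finset.inter_subset_right)) rfl
    rw [hdecomp, this, zero_mul]
  rw [agreeCumulant_eq, ← Finset.sum_subset hsub hzero,
    hins T₁ subset_rfl T₂ subset_rfl, ← sum_agreeCumulant_mul, Finset.sum_mul, sub_eq_zero]
  refine Finset.sum_congr rfl fun S hS => ?_
  have hST : (T₁ ∪ T₂) \ S = (T₁ \ S) ∪ T₂ := by
    rw [Finset.union_sdiff_distrib, Finset.sdiff_eq_self_of_disjoint (s := T₂)]
    exact hd.symm.mono_right (Finset.mem_powerset.1 hS)
  rw [hST, hmul _ Finset.sdiff_subset _ subset_rfl, mul_assoc]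

/-- The vertices met by the target pair `e₀` and the edges of `T`. -/
def spanned (e₀ : VertexPair n) (T : Finset (VertexPair n)) : Finset (Fin n) :=
  ends e₀ ∪ T.biUnion ends

theorem spanned_mono (e₀ : VertexPair n) {S T : Finset (VertexPair n)} (h : S ⊆ T) :
    spanned e₀ S ⊆ spanned e₀ T :=
  Finset.union_subset_union_right (Finset.biUnion_subset_biUnion_of_subset_left _ h)

theorem ends_subset_spanned (e₀ : VertexPair n) {T : Finset (VertexPair n)} {e : VertexPair n}
    (he : e ∈ T) : ends e ⊆ spanned e₀ T :=
  (Finset.subset_biUnion_of_mem ends he).trans Finset.subset_union_right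

theorem spanned_subset {e₀ : VertexPair n} {T : Finset (VertexPair n)} {W : Finset (Fin n)}
    (h₀ : ends e₀ ⊆ W) (h : ∀ e ∈ T, ends e ⊆ W) : spanned e₀ T ⊆ W :=
  Finset.union_subset h₀ (Finset.biUnion_subset.2 h)

theorem two_le_card_spanned (e₀ : VertexPair n) (T : Finset (VertexPair n)) :
    2 ≤ #(spanned e₀ T) :=
  (card_ends e₀).symm.le.trans (Finset.card_le_card Finset.subset_union_left)

/-- Connectedness: if the cumulant of `T` does not vanish, then every vertex of `T` is linked to
`e₀` by edges of `T`. -/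
theorem spanned_subset_of_agreeCumulant_ne_zero [NeZero k] {e₀ : VertexPair n}
    {T : Finset (VertexPair n)} (hT : agreeCumulant k e₀ T ≠ 0) {W : Finset (Fin n)}
    (h₀ : ends e₀ ⊆ W) (hW : ∀ e ∈ T, ends e ⊆ W ∨ Disjoint (ends e) W) :
    spanned e₀ T ⊆ W := by
  classical
  by_contra hcon
  refine hT ?_
  rw [← Finset.filter_union_filter_not_eq (fun e => ends e ⊆ W) T]
  have h1 : ∀ S ⊆ T.filter (fun e => ends e ⊆ W), ∀ e ∈ S, ends e ⊆ W :=
    fun S hS e he => (Finset.mem_filter.1 (hS he)).2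
  have h2 : ∀ S ⊆ T.filter (fun e => ¬ ends e ⊆ W), ∀ e ∈ S, Disjoint (ends e) W := by
    intro S hS e he
    have := Finset.mem_filter.1 (hS he)
    exact (hW e this.1).resolve_left this.2
  refine agreeCumulant_eq_zero_of_split ?_ (Finset.disjoint_filter_filter_not _ _ _) ?_ ?_
  · by_contra hemp
    rw [Finset.not_nonempty_iff_eq_empty, Finset.filter_eq_empty_iff] at hemp
    exact hcon (spanned_subset h₀ fun e he => not_not.1 (hemp he))
  · intro S₁ hS₁ S₂ hS₂
    rw [← Finset.insert_union]
    refine agreeMean_union W (fun e he => ?_) (h2 S₂ hS₂)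
    rcases Finset.mem_insert.1 he with rfl | he
    · exact h₀
    · exact h1 S₁ hS₁ e he
  · exact fun S₁ hS₁ S₂ hS₂ => agreeMean_union W (h1 S₁ hS₁) (h2 S₂ hS₂)

/-- If the cumulant of `T` does not vanish, then `T` covers both vertices of `e₀`. -/
theorem one_le_degree_of_agreeCumulant_ne_zero [NeZero k] {e₀ : VertexPair n}
    {T : Finset (VertexPair n)} (hT : agreeCumulant k e₀ T ≠ 0) (hne : T.Nonempty) {u : Fin n}
    (hu : u ∈ ends e₀) : 1 ≤ #{e ∈ T | u ∈ ends e} := by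
  by_contra! hdeg
  have hno : ∀ e ∈ T, u ∉ ends e :=
    Finset.filter_eq_empty_iff.1 (Finset.card_eq_zero.1 (Nat.lt_one_iff.1 hdeg))
  refine hT ?_
  rw [← Finset.empty_union T]
  refine agreeCumulant_eq_zero_of_split hne (Finset.disjoint_empty_left _) ?_ ?_
  · intro S₁ hS₁ S₂ hS₂
    rw [Finset.subset_empty.1 hS₁, Finset.empty_union,
      agreeMean_insert_pendant hu fun e he => hno e (hS₂ he),
      agreeMean_insert_pendant hu (by simp), agreeMean_empty]
    ring
  · intro S₁ hS₁ S₂ hS₂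
    rw [Finset.subset_empty.1 hS₁, Finset.empty_union, agreeMean_empty, one_mul]

/-- If the cumulant of `T` does not vanish, then `T` has no pendant vertex outside `e₀`. -/
theorem two_le_degree_of_agreeCumulant_ne_zero [NeZero k] {e₀ : VertexPair n}
    {T : Finset (VertexPair n)} (hT : agreeCumulant k e₀ T ≠ 0) {u : Fin n}
    (hu : u ∈ spanned e₀ T) (hu₀ : u ∉ ends e₀) : 2 ≤ #{e ∈ T | u ∈ ends e} := by
  by_contra! hdeg
  obtain ⟨e, heT, hue⟩ : ∃ e ∈ T, u ∈ ends e := by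
    simpa using (Finset.mem_union.1 hu).resolve_left hu₀
  have huniq : ∀ e' ∈ T, u ∈ ends e' → e' = e := fun e' he' hue' =>
    Finset.card_le_one.1 (Nat.lt_succ_iff.1 hdeg) e' (Finset.mem_filter.2 ⟨he', hue'⟩) e
      (Finset.mem_filter.2 ⟨heT, hue⟩)
  have hS : ∀ S ⊆ T.erase e, ∀ e' ∈ S, u ∉ ends e' := fun S hS e' he' hue' =>
    (Finset.mem_erase.1 (hS he')).1 (huniq e' (Finset.mem_erase.1 (hS he')).2 hue')
  refine hT ?_
  rw [← Finset.insert_erase heT, Finset.insert_eq, Finset.union_comm]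
  have hcases : ∀ S ⊆ ({e} : Finset (VertexPair n)), S = ∅ ∨ S = {e} := fun S h =>
    Finset.subset_singleton_iff.1 h
  refine agreeCumulant_eq_zero_of_split (Finset.singleton_nonempty e) (by simp) ?_ ?_
  · intro S₁ hS₁ S₂ hS₂
    rcases hcases S₂ hS₂ with rfl | rfl
    · rw [Finset.union_empty, agreeMean_empty, mul_one]
    · rw [Finset.union_comm, ← Finset.insert_eq, Finset.insert_comm,
        agreeMean_insert_pendant hue, ← insert_empty_eq e,
        agreeMean_insert_pendant (S := ∅) hue (by simp), agreeMean_empty, one_mul]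
      intro e' he'
      rcases Finset.mem_insert.1 he' with rfl | he'
      · exact hu₀
      · exact hS S₁ hS₁ e' he'
  · intro S₁ hS₁ S₂ hS₂
    rcases hcases S₂ hS₂ with rfl | rfl
    · rw [Finset.union_empty, agreeMean_empty, mul_one]
    · rw [Finset.union_comm, ← Finset.insert_eq, agreeMean_insert_pendant hue (hS S₁ hS₁),
        ← insert_empty_eq e, agreeMean_insert_pendant (S := ∅) hue (by simp),
        agreeMean_empty, one_mul]

/-- A non-vanishing cumulant with at least one edge comes from a graph that has at most one vertex
more than edges: all degrees are at least `2` outside `e₀`, and at least `1` on `e₀`. -/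
theorem card_spanned_le [NeZero k] {e₀ : VertexPair n} {T : Finset (VertexPair n)}
    (hT : agreeCumulant k e₀ T ≠ 0) (hne : T.Nonempty) : #(spanned e₀ T) ≤ #T + 1 := by
  have hsum : ∑ u ∈ spanned e₀ T, #{e ∈ T | u ∈ ends e} = #T * 2 := by
    have := Finset.sum_card_bipartiteAbove_eq_sum_card_bipartiteBelow
      (s := spanned e₀ T) (t := T) (fun u e => u ∈ ends e)
    simp only [Finset.bipartiteAbove, Finset.bipartiteBelow] at this
    rw [this, Finset.sum_const_nat fun e he => ?_]
    rw [Finset.filter_mem_eq_inter, Finset.inter_eq_right.2 (ends_subset_spanned e₀ he), card_ends]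
  have hsub : ends e₀ ⊆ spanned e₀ T := Finset.subset_union_left
  have h1 : #(ends e₀) * 1 ≤ ∑ u ∈ ends e₀, #{e ∈ T | u ∈ ends e} :=
    Finset.card_nsmul_le_sum _ _ _ fun u hu => one_le_degree_of_agreeCumulant_ne_zero hT hne hu
  have h2 : #(spanned e₀ T \ ends e₀) * 2 ≤
      ∑ u ∈ spanned e₀ T \ ends e₀, #{e ∈ T | u ∈ ends e} :=
    Finset.card_nsmul_le_sum _ _ _ fun u hu =>
      two_le_degree_of_agreeCumulant_ne_zero hT (Finset.mem_sdiff.1 hu).1 (Finset.mem_sdiff.1 hu).2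
  have h3 := Finset.sum_sdiff hsub (f := fun u => #{e ∈ T | u ∈ ends e})
  have h4 := Finset.card_sdiff_add_card_eq_card hsub
  rw [card_ends] at h1 h4
  omega

/-- Label vectors that both agree along a set `R` of edges and coincide on a vertex set `V`
containing `e₀` coincide on all of `spanned e₀ T`, if the edges of `T` outside `R` stay in `V` and
the cumulant of `T` does not vanish. -/
theorem eqOn_spanned_of_agree [NeZero k] {e₀ : VertexPair n} {R T : Finset (VertexPair n)}
    (hT : agreeCumulant k e₀ T ≠ 0) {V : Finset (Fin n)} (hV : ends e₀ ⊆ V)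
    (hTR : ∀ e ∈ T, e ∈ R ∨ ends e ⊆ V) {z z' : Fin n → Fin k}
    (hz : ∀ e ∈ R, z e.1.1 = z e.1.2) (hz' : ∀ e ∈ R, z' e.1.1 = z' e.1.2)
    (hzz' : ∀ u ∈ V, z u = z' u) : ∀ u ∈ spanned e₀ T, z u = z' u := by
  have hsub : V ⊆ ({u | z u = z' u} : Finset (Fin n)) := fun u hu => by simpa using hzz' u hu
  have := spanned_subset_of_agreeCumulant_ne_zero hT (hV.trans hsub) fun e he => ?_
  · exact fun u hu => by simpa using this hu
  · rcases hTR e he with h | h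
    · have h1 := hz e h
      have h2 := hz' e h
      by_cases h3 : z e.1.1 = z' e.1.1
      · left
        intro u hu
        simp only [ends, Finset.mem_insert, Finset.mem_singleton] at hu
        rcases hu with rfl | rfl
        · simpa using h3
        · simpa [← h1, ← h2] using h3
      · right
        refine Finset.disjoint_left.2 fun u hu => ?_
        simp only [ends, Finset.mem_insert, Finset.mem_singleton] at hu
        rcases hu with rfl | rfl
        · simpa using h3
        · simpa [← h1, ← h2] using h3
    · exact Or.inl (h.trans hsub)

theorem abs_agreeCumulant_le [NeZero k] (e₀ : VertexPair n) (T : Finset (VertexPair n)) :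
    |agreeCumulant k e₀ T| ≤ (#T + 1 : ℝ) ^ #T / (k : ℝ) ^ (#(spanned e₀ T) - 1) := by
  have hk : (0 : ℝ) < k := by exact_mod_cast Nat.pos_of_ne_zero (NeZero.ne k)
  induction T using Finset.strongInduction with
  | _ T ih =>
  by_cases hT : agreeCumulant k e₀ T = 0
  · rw [hT, abs_zero]
    positivity
  have hV2 := two_le_card_spanned e₀ T
  have hfirst : agreeMean k (insert e₀ T) ≤ 1 / (k : ℝ) ^ (#(spanned e₀ T) - 1) := by
    have hmem : e₀.1.1 ∈ spanned e₀ T := Finset.mem_union_left _ (by simp [ends])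
    rw [← Finset.card_erase_of_mem hmem]
    refine agreeMean_le _ fun z z' hz hz' hzz' => ?_
    have hon : ∀ u ∈ spanned e₀ T, z u = z' u := by
      have h1 : z e₀.1.1 = z' e₀.1.1 := hzz' _ (Finset.notMem_erase _ _)
      refine eqOn_spanned_of_agree hT (V := ends e₀) subset_rfl
        (fun e he => Or.inl (Finset.mem_insert_of_mem he)) hz hz' fun u hu => ?_
      simp only [ends, Finset.mem_insert, Finset.mem_singleton] at hu
      rcases hu with rfl | rfl
      · exact h1
      · rw [← hz e₀ (Finset.mem_insert_self _ _), ← hz' e₀ (Finset.mem_insert_self _ _), h1]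
    funext u
    by_cases hu : u ∈ spanned e₀ T
    · exact hon u hu
    · exact hzz' u fun h => hu (Finset.mem_of_mem_erase h)
  have hterm : ∀ S ∈ T.ssubsets, |agreeCumulant k e₀ S * agreeMean k (T \ S)| ≤
      (#T : ℝ) ^ #S / (k : ℝ) ^ (#(spanned e₀ T) - 1) := by
    intro S hS
    have hS' := Finset.mem_ssubsets.1 hS
    have hcard : (#S + 1 : ℝ) ≤ #T := by exact_mod_cast Finset.card_lt_card hS'
    have hsp := spanned_mono e₀ hS'.1
    have hsub : agreeMean k (T \ S) ≤ 1 / (k : ℝ) ^ #(spanned e₀ T \ spanned e₀ S) := by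
      refine agreeMean_le _ fun z z' hz hz' hzz' => ?_
      have hon := eqOn_spanned_of_agree hT (V := spanned e₀ S) Finset.subset_union_left
        (fun e he => (em (e ∈ S)).symm.imp (fun h => Finset.mem_sdiff.2 ⟨he, h⟩)
          (ends_subset_spanned e₀)) hz hz' fun u hu => hzz' u (by simp [hu])
      funext u
      by_cases hu : u ∈ spanned e₀ T
      · exact hon u hu
      · exact hzz' u (by simp [hu])
    have hexp : #(spanned e₀ T) - 1 = (#(spanned e₀ S) - 1) + #(spanned e₀ T \ spanned e₀ S) := by
      have := Finset.card_sdiff_add_card_eq_card hsp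
      have := two_le_card_spanned e₀ S
      omega
    rw [abs_mul, abs_of_nonneg (agreeMean_nonneg _)]
    calc |agreeCumulant k e₀ S| * agreeMean k (T \ S)
        ≤ ((#S + 1 : ℝ) ^ #S / (k : ℝ) ^ (#(spanned e₀ S) - 1)) *
            (1 / (k : ℝ) ^ #(spanned e₀ T \ spanned e₀ S)) :=
          mul_le_mul (ih S hS') hsub (agreeMean_nonneg _) (by positivity)
      _ = (#S + 1 : ℝ) ^ #S / (k : ℝ) ^ (#(spanned e₀ T) - 1) := by
          rw [hexp, pow_add, div_mul_div_comm, mul_one]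
      _ ≤ _ := by gcongr
  have hpow : 1 + ∑ S ∈ T.ssubsets, (#T : ℝ) ^ #S ≤ (#T + 1 : ℝ) ^ #T := by
    have h1 := Finset.sum_pow_mul_eq_add_pow (#T : ℝ) 1 T
    rw [← Finset.add_sum_erase _ _ (Finset.mem_powerset_self T)] at h1
    simp only [one_pow, mul_one] at h1
    rw [← h1]
    refine add_le_add_left ?_ _
    rcases Nat.eq_zero_or_pos #T with h | h
    · simp [h]
    · exact one_le_pow₀ (by exact_mod_cast h)
  rw [agreeCumulant_eq]
  calc |agreeMean k (insert e₀ T) - ∑ S ∈ T.ssubsets, agreeCumulant k e₀ S * agreeMean k (T \ S)|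
      ≤ agreeMean k (insert e₀ T) +
          ∑ S ∈ T.ssubsets, |agreeCumulant k e₀ S * agreeMean k (T \ S)| := by
        refine (abs_sub _ _).trans ?_
        rw [abs_of_nonneg (agreeMean_nonneg _)]
        gcongr
        exact Finset.abs_sum_le_sum_abs _ _
    _ ≤ 1 / (k : ℝ) ^ (#(spanned e₀ T) - 1) +
          ∑ S ∈ T.ssubsets, (#T : ℝ) ^ #S / (k : ℝ) ^ (#(spanned e₀ T) - 1) :=
        add_le_add hfirst (Finset.sum_le_sum hterm)
    _ = (1 + ∑ S ∈ T.ssubsets, (#T : ℝ) ^ #S) / (k : ℝ) ^ (#(spanned e₀ T) - 1) := by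
        rw [← Finset.sum_div, add_div]
    _ ≤ _ := by gcongr

end Cumulant

/-! ### The sum of the squared cumulants -/

section CumulantSum

open Finset BigOperators

variable {n k : ℕ}

theorem card_filter_ends_subset_le (A : Finset (Fin n)) :
    #{e : VertexPair n | ends e ⊆ A} ≤ (#A).choose 2 := by
  rw [← Finset.card_powersetCard]
  refine Finset.card_le_card_of_injOn ends (fun e he => ?_) ends_injective.injOn
  simp only [Finset.coe_filter, Finset.mem_univ, true_and, Set.mem_ofPred_eq] at he
  exact Finset.mem_coe.2 (Finset.mem_powersetCard.2 ⟨he, card_ends e⟩)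

theorem card_filter_spanned_le (e₀ : VertexPair n) {d v : ℕ} (hv : v < d) :
    #{T : Finset (VertexPair n) | #T = d ∧ #(spanned e₀ T) = v + 2} ≤ n ^ v * (d ^ 2) ^ d := by
  have hsub : ({T : Finset (VertexPair n) | #T = d ∧ #(spanned e₀ T) = v + 2} :
      Finset (Finset (VertexPair n))) ⊆ (Finset.powersetCard v Finset.univ).biUnion
        fun U => Finset.powersetCard d {e | ends e ⊆ ends e₀ ∪ U} := by
    intro T hT
    obtain ⟨hTd, hTv⟩ := (Finset.mem_filter.1 hT).2
    have hs : ends e₀ ⊆ spanned e₀ T := Finset.subset_union_left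
    refine Finset.mem_biUnion.2 ⟨spanned e₀ T \ ends e₀, ?_, ?_⟩
    · have := Finset.card_sdiff_add_card_eq_card hs
      rw [card_ends] at this
      exact Finset.mem_powersetCard.2 ⟨Finset.subset_univ _, by omega⟩
    · refine Finset.mem_powersetCard.2 ⟨fun e he => ?_, hTd⟩
      rw [Finset.union_sdiff_of_subset hs]
      simpa using ends_subset_spanned e₀ he
  refine (Finset.card_le_card hsub).trans ((Finset.card_biUnion_le_card_mul _ _ ((d ^ 2) ^ d)
    fun U hU => ?_).trans (Nat.mul_le_mul_right _ ?_))
  · rw [Finset.card_powersetCard]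
    refine (Nat.choose_le_pow _ _).trans (Nat.pow_le_pow_left ?_ d)
    refine (card_filter_ends_subset_le _).trans ?_
    have hA : #(ends e₀ ∪ U) ≤ d + 1 := by
      have := Finset.card_union_le (ends e₀) U
      rw [card_ends, (Finset.mem_powersetCard.1 hU).2] at this
      omega
    refine (Nat.choose_le_choose 2 hA).trans ?_
    rw [Nat.choose_two_right, Nat.add_sub_cancel]
    refine Nat.div_le_of_le_mul ?_
    nlinarith
  · rw [Finset.card_powersetCard, Finset.card_univ, Fintype.card_fin]
    exact Nat.choose_le_pow n v

theorem agreeCumulant_sq_mul_le [NeZero k] (hn : 0 < n) {D : ℕ} {r s : ℝ} (hr : 0 < r)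
    (hs : 0 ≤ s) (hsr : s ≤ r / ((D : ℝ) * (D + 1)) ^ 2 * min ((k : ℝ) ^ 2 / n) 1)
    (e₀ : VertexPair n) {T : Finset (VertexPair n)} {d v : ℕ} (hTd : #T = d) (hd : 1 ≤ d)
    (hdD : d ≤ D) (hTv : #(spanned e₀ T) = v + 2) (hv : v < d) :
    agreeCumulant k e₀ T ^ 2 * s ^ d ≤ r ^ d / ((d : ℝ) ^ 2) ^ d / (n : ℝ) ^ (v + 1) := by
  have hk : (0 : ℝ) < k := by exact_mod_cast Nat.pos_of_ne_zero (NeZero.ne k)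
  have hn' : (0 : ℝ) < n := by exact_mod_cast hn
  have hd' : (0 : ℝ) < d := by exact_mod_cast hd
  have hdD' : (d : ℝ) ≤ D := by exact_mod_cast hdD
  have h1 : agreeCumulant k e₀ T ^ 2 ≤ ((d + 1 : ℝ) ^ d / (k : ℝ) ^ (v + 1)) ^ 2 := by
    rw [← sq_abs]
    have := abs_agreeCumulant_le (k := k) e₀ T
    rw [hTd, hTv, show v + 2 - 1 = v + 1 from rfl] at this
    gcongr
  set m := min ((k : ℝ) ^ 2 / n) 1 with hm
  have hm0 : 0 ≤ m := le_min (by positivity) zero_le_one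
  have h2 : m ^ d ≤ ((k : ℝ) ^ 2 / n) ^ (v + 1) :=
    (pow_le_pow_of_le_one hm0 (min_le_right _ _) hv).trans
      (pow_le_pow_left₀ hm0 (min_le_left _ _) _)
  have h3 : s ^ d ≤ (r / ((d : ℝ) * (d + 1)) ^ 2) ^ d * ((k : ℝ) ^ 2 / n) ^ (v + 1) := by
    calc s ^ d ≤ (r / ((D : ℝ) * (D + 1)) ^ 2 * m) ^ d := by gcongr
      _ ≤ (r / ((d : ℝ) * (d + 1)) ^ 2 * m) ^ d := by gcongr
      _ = (r / ((d : ℝ) * (d + 1)) ^ 2) ^ d * m ^ d := mul_pow _ _ _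
      _ ≤ _ := by gcongr
  calc agreeCumulant k e₀ T ^ 2 * s ^ d
      ≤ ((d + 1 : ℝ) ^ d / (k : ℝ) ^ (v + 1)) ^ 2 *
          ((r / ((d : ℝ) * (d + 1)) ^ 2) ^ d * ((k : ℝ) ^ 2 / n) ^ (v + 1)) :=
        mul_le_mul h1 h3 (by positivity) (by positivity)
    _ = r ^ d / ((d : ℝ) ^ 2) ^ d / (n : ℝ) ^ (v + 1) := by
        have e1 : ((d + 1 : ℝ) ^ d) ^ 2 = ((d + 1 : ℝ) ^ 2) ^ d := by rw [← pow_mul, ← pow_mul,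
          mul_comm]
        have e2 : ((k : ℝ) ^ (v + 1)) ^ 2 = ((k : ℝ) ^ 2) ^ (v + 1) := by
          rw [← pow_mul, ← pow_mul, mul_comm]
        rw [div_pow, e1, e2, div_pow, div_pow, mul_pow, mul_pow]
        field_simp

theorem sum_agreeCumulant_sq_le [NeZero k] (hn : 0 < n) {D : ℕ} {r s : ℝ} (hr : 0 < r)
    (hr1 : r < 1) (hs : 0 ≤ s)
    (hsr : s ≤ r / ((D : ℝ) * (D + 1)) ^ 2 * min ((k : ℝ) ^ 2 / n) 1) (e₀ : VertexPair n) :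
    ∑ T : Finset (VertexPair n) with #T ≤ D, agreeCumulant k e₀ T ^ 2 * s ^ #T ≤
      1 / (k : ℝ) ^ 2 + r * (2 - r) / ((1 - r) ^ 2 * n) := by
  classical
  have hn' : (0 : ℝ) < n := by exact_mod_cast hn
  have hempty : agreeCumulant k e₀ ∅ = 1 / k := by
    have := sum_agreeCumulant_mul (k := k) e₀ ∅
    rw [Finset.powerset_empty, Finset.sum_singleton, Finset.sdiff_self, agreeMean_empty, mul_one,
      agreeMean_insert_pendant (u := e₀.1.1) (by simp [ends]) (by simp), agreeMean_empty,
      one_mul] at this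
    exact this
  set 𝒯 : Finset (Finset (VertexPair n)) :=
    {T | (#T ≤ D ∧ T.Nonempty) ∧ agreeCumulant k e₀ T ≠ 0} with h𝒯
  have hsplit : ∑ T : Finset (VertexPair n) with #T ≤ D, agreeCumulant k e₀ T ^ 2 * s ^ #T =
      1 / (k : ℝ) ^ 2 + ∑ T ∈ 𝒯, agreeCumulant k e₀ T ^ 2 * s ^ #T := by
    have hsub : insert ∅ 𝒯 ⊆ ({T | #T ≤ D} : Finset (Finset (VertexPair n))) := by
      intro T hT
      rcases Finset.mem_insert.1 hT with rfl | hT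
      · simp
      · simpa using (Finset.mem_filter.1 hT).2.1.1
    rw [← Finset.sum_subset hsub, Finset.sum_insert (by simp [h𝒯]), hempty]
    · simp
    · intro T hT hT'
      have hT0 : agreeCumulant k e₀ T = 0 := by
        by_contra hne
        refine hT' ?_
        rcases T.eq_empty_or_nonempty with rfl | h
        · exact Finset.mem_insert_self _ _
        · refine Finset.mem_insert_of_mem (Finset.mem_filter.2 ⟨Finset.mem_univ _, ⟨?_, h⟩, hne⟩)
          simpa using hT
      simp [hT0]
  -- the pair (number of edges, number of vertices outside `e₀`) of a contributing graph
  let shape : Finset (VertexPair n) → (_ : ℕ) × ℕ := fun T => ⟨#T, #(spanned e₀ T) - 2⟩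
  have hmaps : ∀ T ∈ 𝒯, shape T ∈ (Finset.Icc 1 D).sigma fun d => Finset.range d := by
    intro T hT
    obtain ⟨⟨hD, hne⟩, hT0⟩ := (Finset.mem_filter.1 hT).2
    have h1 := card_spanned_le hT0 hne
    have h2 := two_le_card_spanned e₀ T
    have h3 := hne.card_pos
    refine Finset.mem_sigma.2 ⟨Finset.mem_Icc.2 ⟨h3, hD⟩, Finset.mem_range.2 ?_⟩
    simp only [shape]
    omega
  have hfiber : ∀ x ∈ (Finset.Icc 1 D).sigma fun d => Finset.range d,
      ∑ T ∈ 𝒯 with shape T = x, agreeCumulant k e₀ T ^ 2 * s ^ #T ≤ r ^ x.1 / n := by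
    rintro ⟨d, v⟩ hx
    obtain ⟨hd, hv⟩ := Finset.mem_sigma.1 hx
    obtain ⟨hd1, hdD⟩ := Finset.mem_Icc.1 hd
    have hv := Finset.mem_range.1 hv
    simp only at hd1 hdD hv
    have hshape : ∀ T, shape T = ⟨d, v⟩ → #T = d ∧ #(spanned e₀ T) = v + 2 := by
      intro T hT
      have h2 := two_le_card_spanned e₀ T
      simp only [shape, Sigma.mk.injEq, heq_eq_eq] at hT
      omega
    have hd' : (0 : ℝ) < d := by exact_mod_cast hd1
    have hcard : (#{T ∈ 𝒯 | shape T = ⟨d, v⟩} : ℝ) ≤ (n : ℝ) ^ v * ((d : ℝ) ^ 2) ^ d := by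
      exact_mod_cast (Finset.card_le_card fun T hT => Finset.mem_filter.2
        ⟨Finset.mem_univ _, hshape T (Finset.mem_filter.1 hT).2⟩).trans
          (card_filter_spanned_le e₀ hv)
    calc ∑ T ∈ 𝒯 with shape T = ⟨d, v⟩, agreeCumulant k e₀ T ^ 2 * s ^ #T
        ≤ #{T ∈ 𝒯 | shape T = ⟨d, v⟩} • (r ^ d / ((d : ℝ) ^ 2) ^ d / (n : ℝ) ^ (v + 1)) := by
          refine Finset.sum_le_card_nsmul _ _ _ fun T hT => ?_
          obtain ⟨h1, h2⟩ := hshape T (Finset.mem_filter.1 hT).2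
          rw [h1]
          exact agreeCumulant_sq_mul_le hn hr hs hsr e₀ h1 hd1 hdD h2 hv
      _ ≤ ((n : ℝ) ^ v * ((d : ℝ) ^ 2) ^ d) *
            (r ^ d / ((d : ℝ) ^ 2) ^ d / (n : ℝ) ^ (v + 1)) := by
          rw [nsmul_eq_mul]
          gcongr
      _ = r ^ d / n := by
          field_simp
          ring
  have hgeom : ∑ d ∈ Finset.Icc 1 D, (d : ℝ) * r ^ d ≤ r / (1 - r) ^ 2 := by
    have hnorm : ‖r‖ < 1 := by rwa [Real.norm_of_nonneg hr.le]
    rw [← tsum_coe_mul_geometric_of_norm_lt_one hnorm]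
    exact (hasSum_coe_mul_geometric_of_norm_lt_one hnorm).summable.sum_le_tsum _
      fun d _ => by positivity
  rw [hsplit]
  gcongr
  calc ∑ T ∈ 𝒯, agreeCumulant k e₀ T ^ 2 * s ^ #T
      = ∑ x ∈ (Finset.Icc 1 D).sigma fun d => Finset.range d,
          ∑ T ∈ 𝒯 with shape T = x, agreeCumulant k e₀ T ^ 2 * s ^ #T :=
        (Finset.sum_fiberwise_of_maps_to hmaps _).symm
    _ ≤ ∑ x ∈ (Finset.Icc 1 D).sigma fun d => Finset.range d, r ^ x.1 / n :=
        Finset.sum_le_sum hfiber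
    _ = (∑ d ∈ Finset.Icc 1 D, (d : ℝ) * r ^ d) / n := by
        rw [Finset.sum_sigma, Finset.sum_div]
        refine Finset.sum_congr rfl fun d _ => ?_
        simp [mul_div_assoc]
    _ ≤ (r / (1 - r) ^ 2) / n := by gcongr
    _ = r * 1 / ((1 - r) ^ 2 * n) := by rw [div_div, mul_one]
    _ ≤ r * (2 - r) / ((1 - r) ^ 2 * n) := by
        have : 0 < 1 - r := by linarith
        gcongr
        linarith

end CumulantSum

/-! ### The Bayes risk as a finite average -/

section Risk

open Finset BigOperators

variable {n k : ℕ}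

theorem bitPoly_mono {E : Type*} {c d : ℕ} (h : c ≤ d) : bitPoly E c ≤ bitPoly E d :=
  Submodule.span_mono fun _ ⟨T, hT, hf⟩ => ⟨T, hT.trans h, hf⟩

theorem const_mem_bitPoly {E : Type*} (c : ℝ) (D : ℕ) : (fun _ => c) ∈ bitPoly E D := by
  have h1 : (fun _ : E → Bool => (1 : ℝ)) ∈ bitPoly E D :=
    Submodule.subset_span ⟨∅, by simp, by simp⟩
  simpa [Pi.smul_def] using Submodule.smul_mem _ c h1

theorem mul_mem_bitPoly {E : Type*} [DecidableEq E] {c d : ℕ} {f g : (E → Bool) → ℝ}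
    (hf : f ∈ bitPoly E c) (hg : g ∈ bitPoly E d) : f * g ∈ bitPoly E (c + d) := by
  have h := Submodule.mul_mem_mul hf hg
  rw [bitPoly, bitPoly, Submodule.span_mul_span] at h
  refine Submodule.span_mono ?_ h
  rintro _ ⟨_, ⟨S, hS, rfl⟩, _, ⟨T, hT, rfl⟩, rfl⟩
  refine ⟨S ∪ T, (Finset.card_union_le S T).trans (add_le_add hS hT), ?_⟩
  funext a
  simp only [Pi.mul_apply, bitVal, Finset.prod_ite_zero, Finset.prod_const_one,
    Finset.forall_mem_union]
  split_ifs <;> simp_all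

theorem pow_mem_bitPoly {E : Type*} [DecidableEq E] {f : (E → Bool) → ℝ}
    (hf : f ∈ bitPoly E 1) (m : ℕ) : f ^ m ∈ bitPoly E m := by
  induction m with
  | zero => exact const_mem_bitPoly 1 0
  | succ m ih => exact pow_succ f m ▸ mul_mem_bitPoly ih hf

theorem prod_mem_bitPoly {E ι : Type*} [DecidableEq E] (s : Finset ι) {d : ι → ℕ}
    {f : ι → (E → Bool) → ℝ} (hf : ∀ i ∈ s, f i ∈ bitPoly E (d i)) :
    ∏ i ∈ s, f i ∈ bitPoly E (∑ i ∈ s, d i) := by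
  classical
  induction s using Finset.induction_on with
  | empty => exact const_mem_bitPoly 1 0
  | insert i s hi ih =>
    rw [Finset.prod_insert hi, Finset.sum_insert hi]
    exact mul_mem_bitPoly (hf i (Finset.mem_insert_self i s))
      (ih fun j hj => hf j (Finset.mem_insert_of_mem hj))

theorem adjacency_mem_bitPoly (i j : Fin n) :
    (fun a => adjacency a i j) ∈ bitPoly (VertexPair n) 1 := by
  have h : ∀ e : VertexPair n, (fun a => if a e then (1 : ℝ) else 0) ∈ bitPoly (VertexPair n) 1 :=
    fun e => Submodule.subset_span ⟨{e}, by simp, by simp [bitVal]⟩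
  unfold adjacency
  split_ifs
  · exact h _
  · exact h _
  · exact const_mem_bitPoly 0 1

theorem eval_adjacency_mem_bitPoly {D : ℕ} {f : MvPolynomial (Fin n × Fin n) ℝ}
    (hf : f.totalDegree ≤ D) :
    (fun a => MvPolynomial.eval (fun e : Fin n × Fin n => adjacency a e.1 e.2) f) ∈
      bitPoly (VertexPair n) D := by
  have h : (fun a => MvPolynomial.eval (fun e : Fin n × Fin n => adjacency a e.1 e.2) f) =
      ∑ m ∈ f.support, f.coeff m •
        ∏ e ∈ m.support, (fun a : VertexPair n → Bool => adjacency a e.1 e.2) ^ m e := by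
    funext a
    simp [MvPolynomial.eval_eq]
  rw [h]
  refine Submodule.sum_mem _ fun m hm => Submodule.smul_mem _ _ ?_
  exact bitPoly_mono ((MvPolynomial.le_totalDegree hm).trans hf)
    (prod_mem_bitPoly _ fun e _ => pow_mem_bitPoly (adjacency_mem_bitPoly e.1 e.2) (m e))

theorem integral_graphLaw (M : Fin n → Fin n → unitInterval) (F : (VertexPair n → Bool) → ℝ) :
    ∫ a, F a ∂(graphLaw M) = bitMean (fun e => (M e.1.1 e.1.2 : ℝ)) F := by
  unfold graphLaw
  rw [integral_fintype .of_finite, bitMean]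
  refine Finset.sum_congr rfl fun a _ => ?_
  rw [smul_eq_mul, Measure.real_def, Measure.pi_singleton, ENNReal.toReal_prod]
  congr 1
  refine Finset.prod_congr rfl fun e _ => ?_
  rw [← Measure.real_def, bernoulliMeasure_real_apply _ (measurableSet_singleton _)]
  cases a e <;> simp

theorem integral_sbmPrior [NeZero k] (p q : unitInterval)
    {G : (Fin n → Fin n → unitInterval) → ℝ} (hG : Measurable G) :
    ∫ M, G M ∂(sbmPrior n k p q) = 𝔼 z : Fin n → Fin k, G (sbmMatrix p q z) := by
  have : IsProbabilityMeasure (uniformOn (Set.univ : Set (Fin k))) :=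
    isProbabilityMeasure_uniformOn Set.finite_univ Set.univ_nonempty
  rw [sbmPrior, integral_map (measurable_of_finite _).aemeasurable hG.aestronglyMeasurable,
    integral_fintype .of_finite, Fintype.expect_eq_sum_div_card, Finset.sum_div]
  refine Finset.sum_congr rfl fun z _ => ?_
  rw [smul_eq_mul, Measure.real_def, Measure.pi_singleton, ENNReal.toReal_prod]
  simp [uniformOn_univ, div_eq_inv_mul]

theorem sbmBayesRisk_eq [NeZero k] (p q : unitInterval)
    (Mhat : Matrix (Fin n) (Fin n) ℝ → Matrix (Fin n) (Fin n) ℝ) :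
    sbmBayesRisk n k p q Mhat = (1 / (n.choose 2 : ℝ)) * ∑ e : VertexPair n,
      𝔼 z : Fin n → Fin k, bitMean (fun e => (sbmMatrix p q z e.1.1 e.1.2 : ℝ))
        (fun a => (Mhat (adjacency a) e.1.1 e.1.2 - (sbmMatrix p q z e.1.1 e.1.2 : ℝ)) ^ 2) := by
  unfold sbmBayesRisk
  simp only [integral_graphLaw]
  rw [integral_sbmPrior]
  · simp only [empiricalLoss, bitMean_const_mul, bitMean_sum, ← Finset.mul_expect,
      Finset.expect_sum_comm]
  · refine Continuous.measurable ?_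
    unfold bitMean empiricalLoss
    refine continuous_finsetSum _ fun a _ => Continuous.mul ?_ (by fun_prop)
    refine continuous_finsetProd _ fun e _ => ?_
    split_ifs <;> fun_prop

theorem card_vertexPair (n : ℕ) : Fintype.card (VertexPair n) = n.choose 2 := by
  have h : Finset.univ.image (ends (n := n)) = Finset.powersetCard 2 Finset.univ := by
    ext s
    simp only [Finset.mem_image, Finset.mem_univ, true_and, Finset.mem_powersetCard,
      Finset.subset_univ]
    constructor
    · rintro ⟨e, rfl⟩
      exact card_ends e
    · intro hs
      obtain ⟨a, b, hab, rfl⟩ := Finset.card_eq_two.1 hs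
      rcases hab.lt_or_gt with h | h
      · exact ⟨⟨(a, b), h⟩, rfl⟩
      · exact ⟨⟨(b, a), h⟩, Finset.pair_comm b a⟩
  rw [← Finset.card_univ, ← Finset.card_image_of_injective _ ends_injective, h,
    Finset.card_powersetCard, Finset.card_univ, Fintype.card_fin]

theorem sbmMatrix_apply (p q : unitInterval) (z : Fin n → Fin k) (e : VertexPair n) :
    (sbmMatrix p q z e.1.1 e.1.2 : ℝ) = q + ((p : ℝ) - q) * agree z e := by
  simp only [sbmMatrix, agree, e.2.ne, if_false]
  split_ifs <;> simp

/-- The low-degree lower bound for a single entry of the connectivity matrix. -/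
theorem entry_risk_ge [NeZero k] {D : ℕ} (hn : 0 < n) {p q : unitInterval}
    (hq : (0 : ℝ) < q) (hqp : (q : ℝ) ≤ p) (hp : (p : ℝ) < 1) {r : ℝ} (hr0 : 0 < r) (hr1 : r < 1)
    (hSNR : ((p : ℝ) - q) ^ 2 / ((q : ℝ) * (1 - p)) ≤
      r / ((D : ℝ) * (D + 1)) ^ 2 * min ((k : ℝ) ^ 2 / n) 1) (e₀ : VertexPair n)
    {f : (VertexPair n → Bool) → ℝ} (hf : f ∈ bitPoly (VertexPair n) D) :
    ((p : ℝ) - q) ^ 2 / k -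
        ((p : ℝ) - q) ^ 2 * (1 / (k : ℝ) ^ 2 + r * (2 - r) / ((1 - r) ^ 2 * n)) ≤
      𝔼 z : Fin n → Fin k, bitMean (fun e => (sbmMatrix p q z e.1.1 e.1.2 : ℝ))
        (fun a => (f a - (sbmMatrix p q z e₀.1.1 e₀.1.2 : ℝ)) ^ 2) := by
  simp only [sbmMatrix_apply]
  have hagree : ∀ (z : Fin n → Fin k) e, 0 ≤ agree z e ∧ agree z e ≤ 1 ∧
      agree z e * agree z e = agree z e := fun z e => by
    unfold agree; split_ifs <;> norm_num
  have hδ : 0 ≤ (p : ℝ) - q := sub_nonneg.2 hqp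
  have hden : 0 < (q : ℝ) * (1 - p) := mul_pos hq (by linarith)
  have hf' : (fun a => f a + -(q : ℝ)) ∈ bitPoly (VertexPair n) D :=
    Submodule.add_mem _ hf (const_mem_bitPoly (-(q : ℝ)) D)
  have hinsert : ∀ T : Finset (VertexPair n), agreeMean k (insert e₀ T) =
      𝔼 z : Fin n → Fin k, agree z e₀ * ∏ e ∈ T, agree z e := by
    intro T
    refine Finset.expect_congr rfl fun z _ => ?_
    by_cases h : e₀ ∈ T
    · rw [Finset.insert_eq_of_mem h, ← Finset.mul_prod_erase T _ h, ← mul_assoc, (hagree z e₀).2.2]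
    · rw [Finset.prod_insert h]
  have key := bitPoly_risk_ge (fun (z : Fin n → Fin k) e => (q : ℝ) + ((p : ℝ) - q) * agree z e)
    (fun z => ((p : ℝ) - q) * agree z e₀) hq hp
    (fun z e => by nlinarith [hagree z e]) (fun z e => by nlinarith [hagree z e]) D
    (fun S => ((p : ℝ) - q) ^ (#S + 1) * agreeCumulant k e₀ S) (fun T _ => by
      simp only [add_sub_cancel_left, Finset.prod_mul_distrib, Finset.prod_const]
      have h1 : ∀ z : Fin n → Fin k, ((p : ℝ) - q) * agree z e₀ *
          (((p : ℝ) - q) ^ #T * ∏ e ∈ T, agree z e) =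
            ((p : ℝ) - q) ^ (#T + 1) * (agree z e₀ * ∏ e ∈ T, agree z e) := fun z => by ring
      simp only [h1, ← Finset.mul_expect]
      rw [← hinsert, ← sum_agreeCumulant_mul, Finset.mul_sum]
      refine Finset.sum_congr rfl fun S hS => ?_
      rw [← Finset.card_sdiff_add_card_eq_card (Finset.mem_powerset.1 hS), agreeMean]
      ring) hf'
  have hsecond : 𝔼 z : Fin n → Fin k, (((p : ℝ) - q) * agree z e₀) ^ 2 =
      ((p : ℝ) - q) ^ 2 / k := by
    have h1 : ∀ z : Fin n → Fin k, (((p : ℝ) - q) * agree z e₀) ^ 2 =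
        ((p : ℝ) - q) ^ 2 * (agree z e₀ * ∏ e ∈ ∅, agree z e) := fun z => by
      rw [mul_pow, sq (agree z e₀), (hagree z e₀).2.2, Finset.prod_empty, mul_one]
    simp only [h1, ← Finset.mul_expect]
    rw [← hinsert, agreeMean_insert_pendant (u := e₀.1.1) (by simp [ends]) (by simp),
      agreeMean_empty, one_mul, mul_one_div]
  have hsum : ∑ S : Finset (VertexPair n) with #S ≤ D,
      (((p : ℝ) - q) ^ (#S + 1) * agreeCumulant k e₀ S) ^ 2 / ((q : ℝ) * (1 - p)) ^ #S ≤
        ((p : ℝ) - q) ^ 2 * (1 / (k : ℝ) ^ 2 + r * (2 - r) / ((1 - r) ^ 2 * n)) := by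
    have h1 := sum_agreeCumulant_sq_le hn hr0 hr1 (by positivity) hSNR e₀
    refine le_trans (le_of_eq ?_) (mul_le_mul_of_nonneg_left h1 (sq_nonneg ((p : ℝ) - q)))
    rw [Finset.mul_sum]
    refine Finset.sum_congr rfl fun S _ => ?_
    rw [div_pow, ← pow_mul]
    ring
  rw [hsecond] at key
  refine ((sub_le_sub_left hsum _).trans key).trans (le_of_eq ?_)
  refine Finset.expect_congr rfl fun z _ => ?_
  congr 1
  funext a
  ring

end Risk

theorem theorem2 (n k D : ℕ) (hn : 2 ≤ n) (hk : 1 ≤ k) (hD : 1 ≤ D)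
    (p q : unitInterval) (hq : (0 : ℝ) < q) (hqp : (q : ℝ) ≤ p) (hp : (p : ℝ) < 1)
    (r : ℝ) (hr0 : 0 < r) (hr1 : r < 1)
    (hSNR : ((p : ℝ) - q) ^ 2 / ((q : ℝ) * (1 - p)) ≤
      r / ((D : ℝ) * (D + 1)) ^ 2 * min ((k : ℝ) ^ 2 / n) 1) :
    ((p : ℝ) - q) ^ 2 / k -
        ((p : ℝ) - q) ^ 2 * (1 / (k : ℝ) ^ 2 + r * (2 - r) / ((1 - r) ^ 2 * n)) ≤
      ⨅ Mhat : lowDegreeEstimators n D, sbmBayesRisk n k p q Mhat.1 := by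
  have : NeZero k := ⟨by omega⟩
  refine le_ciInf fun ⟨Mhat, hM⟩ => ?_
  have hC : (0 : ℝ) < n.choose 2 := by exact_mod_cast Nat.choose_pos hn
  rw [sbmBayesRisk_eq, one_div_mul_eq_div, le_div_iff₀ hC, mul_comm, ← card_vertexPair,
    ← Finset.card_univ, ← nsmul_eq_mul]
  refine Finset.card_nsmul_le_sum _ _ _ fun e _ => ?_
  obtain ⟨f, hf, hMf⟩ := hM e.1.1 e.1.2
  refine entry_risk_ge (by omega) hq hqp hp hr0 hr1 hSNR e ?_
  simp only [hMf]
  exact eval_adjacency_mem_bitPoly hf
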